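/- Let $Q\in\mathbb{R}^{n\times n}$ be symmetric positive semidefinite, let $c,a,l,u\in\mathbb{R}^n$ and $d\in\mathbb{R}$ with $l_i<u_i$ for all $i$, and put $K=\{x: l\le x\le u\}$, $L=\{x: a^Tx=d\}$, where $K\cap L\neq\emptyset$. Let $\Pi$ be the Euclidean projector onto $K\cap L$ and $\delta^*(z)=\max_{y\in K\cap L}\langle z,y\rangle$. Fix $x^k\in\mathbb{R}^n$ and $\sigma_k>0$, and let $$\psi^k(w)=\inf_{z\in\mathbb{R}^n}\Big\{\tfrac12\langle w,Qw\rangle+\delta^*(z)+\tfrac{\sigma_k}{2}\big\|Qw+z+c-\tfrac{1}{\sigma_k}x^k\big\|^2-\tfrac{1}{2\sigma_k}\|x^k\|^2\Big\},\qquad u(w)=x^k-\sigma_k(Qw+c).$$ The HS-Jacobian $\mathscr{P}(v)$ of $\Pi$ at $v$ is defined as follows. Write $K=\{x: Ax\ge g\}$ with $A=[I;-I]$, $g=[l;-u]$, and let $I(v)=\{i: A_i\Pi(v)=g_i\}$. Then $\mathscr{P}(v)$ consists of the matrices $I-N_J^T(N_JN_J^T)^{-1}N_J$, where $N_J$ is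 the matrix with rows $A_i$ $(i\in J)$ and $a^T$, and $J\subseteq I(v)$ is any index set such that $N_J$ has full row rank and $\operatorname{supp}(\lambda)\subseteq J$ for some $(\lambda,m)$ with $\Pi(v)-v-A^T\lambda-m\,a=0$, $\lambda\ge0$, $\langle\lambda,A\Pi(v)-g\rangle=0$. (If $a=0$, the row $a^T$ is omitted.) Let $\mu\in(0,\frac12)$, $\delta\in(0,1)$, $\tau\in(0,1]$, $\eta\in(0,1)$ and $w^0\in\mathrm{Ran}(Q)$, and let $\{w^j\}_{j\ge0}$ be an infinite sequence generated by the semismooth Newton method: for $j=0,1,2,\dots$ 1. Choose $P_j\in\mathscr{P}(u(w^j))$, put $M_j=Q+\sigma_kQP_jQ$, and let $d_j\in\mathrm{Ran}(Q)$ be an iterate of the conjugate gradient method, started at $0$, for the system $M_jd+\nabla\psi^k(w^j)=0$, such that $\|M_jd_j+\nabla\psi^k(w^j)\|\le\min\big(\eta,\|\nabla\psi^k(w^j)\|^{1+\tau}\big)$. 2. Let $m_j$ be the smallest integer $m\ge0$ with $\psi^k(w^j+\delta^md_j)\le\psi^k(w^j)+\mu\delta^m\langle\nabla\psi^k(w^j),d_j\rangle$.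 3. Set $w^{j+1}=w^j+\delta^{m_j}d_j$. Then $\psi^k$ is differentiable; the equation $\nabla\psi^k(w)=0$, $w\in\mathrm{Ran}(Q)$, has a unique solution $\tilde w$, and $\tilde w$ minimizes $\psi^k$ over $\mathrm{Ran}(Q)$; the sequence $\{w^j\}$ converges to $\tilde w$; and $$\|w^{j+1}-\tilde w\|=O\big(\|w^j-\tilde w\|^{1+\tau}\big)\qquad(j\to\infty).$$ -/

import Mathlib

open Filter Topology Asymptotics

noncomputable section

namespace SsN

/-- The space `ℝⁿ` with its Euclidean norm and inner product. -/
abbrev E (n : ℕ) := EuclideanSpace ℝ (Fin n)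

/-- The data of the quadratic program
`min ½ xᵀQx + cᵀx  subject to  aᵀx = d,  l ≤ x ≤ u`. -/
structure QPData (n : ℕ) where
  Q : Matrix (Fin n) (Fin n) ℝ
  c : E n
  a : E n
  l : E n
  u : E n
  d : ℝ

/-- A Euclidean projection of `v` onto `S`: a point of `S` nearest to `v`
(it exists and is unique when `S` is nonempty, closed and convex). -/
def proj {n : ℕ} (S : Set (E n)) (v : E n) : E n :=
  Classical.epsilon fun x => x ∈ S ∧ ∀ y ∈ S, ‖x - v‖ ≤ ‖y - v‖

/-- The support function of `S`, i.e. the conjugate of the indicator function of `S`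
(real valued when `S` is nonempty and bounded). -/
def supportFn {n : ℕ} (S : Set (E n)) (z : E n) : ℝ :=
  ⨆ x : S, inner ℝ z (x : E n)

/-! ### The conjugate gradient method -/

/-- State of the conjugate gradient method: current solution, residual, search direction. -/
structure CGState (n : ℕ) where
  sol : E n
  res : E n
  dir : E n

/-- One step of the conjugate gradient method for `M d = b`. Once the residual is `0`,
the convention `0 / 0 = 0` makes the solution stay the same. -/
def cgStep {n : ℕ} (M : E n →L[ℝ] E n) (s : CGState n) : CGState n :=
  let α : ℝ := inner ℝ s.res s.res / inner ℝ s.dir (M s.dir)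
  let r : E n := s.res - α • M s.dir
  let β : ℝ := inner ℝ r r / inner ℝ s.res s.res
  { sol := s.sol + α • s.dir
    res := r
    dir := r + β • s.dir }

/-- The conjugate gradient method for `M d = b` after `i` steps, started at `d = 0`. -/
def cgIter {n : ℕ} (M : E n →L[ℝ] E n) (b : E n) : ℕ → CGState n
  | 0 => { sol := 0, res := b, dir := b }
  | i + 1 => cgStep M (cgIter M b i)

namespace QPData

variable {n : ℕ} (D : QPData n)

/-- The box `K = {x | l ≤ x ≤ u}`. -/
def box : Set (E n) := {x | ∀ i, D.l i ≤ x i ∧ x i ≤ D.u i}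

/-- The hyperplane `L = {x | aᵀx = d}`. -/
def hyperplane : Set (E n) := {x | inner ℝ D.a x = D.d}

/-- The feasible set `K ∩ L`. -/
def feasible : Set (E n) := D.box ∩ D.hyperplane

/-- `Q` as an operator on `ℝⁿ`. -/
def Qop : E n →L[ℝ] E n := Matrix.toEuclideanCLM (𝕜 := ℝ) D.Q

/-- `Ran(Q)`. -/
def ranQ : Submodule ℝ (E n) := LinearMap.range (D.Qop : E n →ₗ[ℝ] E n)

/-! ### The inner subproblem of the augmented Lagrangian method -/

/-- The augmented Lagrangian
`L_σ(w, z; x) = ½⟨w, Qw⟩ + δ*(z) + (σ/2)‖Qw + z + c - x/σ‖² - (1/(2σ))‖x‖²`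
of the dual problem, where `δ*` is the support function of `K ∩ L`. -/
def augLagrangian (σ : ℝ) (w z x : E n) : ℝ :=
  1 / 2 * inner ℝ w (D.Qop w) + supportFn D.feasible z
    + σ / 2 * ‖D.Qop w + z + D.c - (1 / σ) • x‖ ^ 2 - 1 / (2 * σ) * ‖x‖ ^ 2

/-- `ψ(w) = inf_z L_σ(w, z; x)`. -/
def psi (x : E n) (σ : ℝ) (w : E n) : ℝ := ⨅ z : E n, D.augLagrangian σ w z x

/-- `u(w) = x - σ (Q w + c)`. -/
def uArg (x : E n) (σ : ℝ) (w : E n) : E n := x - σ • (D.Qop w + D.c)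

/-! ### The HS-Jacobian (Han and Sun) of the projector onto `K ∩ L` -/

/-- The rows of `A = [I; -I]`, the box being written as `A x ≥ g`. -/
def rowA : Fin n ⊕ Fin n → E n
  | Sum.inl i => EuclideanSpace.single i (1 : ℝ)
  | Sum.inr i => -EuclideanSpace.single i (1 : ℝ)

/-- The right-hand side `g = [l; -u]`. -/
def rhsG : Fin n ⊕ Fin n → ℝ
  | Sum.inl i => D.l i
  | Sum.inr i => -D.u i

/-- Indices of the inequality constraints that are active at the projection of `v`. -/
def activeSet (v : E n) : Set (Fin n ⊕ Fin n) :=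
  {i | inner ℝ (rowA i) (proj D.feasible v) = D.rhsG i}

/-- `(lam, m)` are KKT multipliers of `min ½‖y - v‖²  s.t.  aᵀy = d, A y ≥ g`
at its solution `y`, the projection of `v`. -/
def IsMultiplier (v : E n) (lam : Fin n ⊕ Fin n → ℝ) (m : ℝ) : Prop :=
  proj D.feasible v - v - ∑ i, lam i • rowA i - m • D.a = 0 ∧
  (∀ i, 0 ≤ lam i) ∧
  ∀ i, lam i * (inner ℝ (rowA i) (proj D.feasible v) - D.rhsG i) = 0

/-- The index sets `J` with `supp(lam) ⊆ J ⊆ activeSet v` for some multiplier `lam`, and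
with the rows `A_J` linearly independent of each other and of `a`. When `a ≠ 0` the last two
conditions say that the matrix with rows `A_J`, `a` has full row rank; when `a = 0` the
equality constraint is void and they say that `A_J` has full row rank. -/
def basisSets (v : E n) : Set (Set (Fin n ⊕ Fin n)) :=
  {J | (∃ lam m, D.IsMultiplier v lam m ∧ Function.support lam ⊆ J) ∧
    J ⊆ D.activeSet v ∧
    LinearIndependent ℝ (fun i : J => rowA (i : Fin n ⊕ Fin n)) ∧
    Disjoint (Submodule.span ℝ (rowA '' J)) (Submodule.span ℝ {D.a})}

/-- The HS-Jacobian of the projector at `v`: all matrices `I - Nᵀ(N Nᵀ)⁻¹N`, where `N` has the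
rows `A_J` and `a`, for `J ∈ basisSets v`. This matrix is the orthogonal projector onto the
kernel of `N`, i.e. onto the orthogonal complement of the span of the rows of `N`. -/
def hsJacobian (v : E n) : Set (E n →L[ℝ] E n) :=
  {P | ∃ J ∈ D.basisSets v,
    P = ((Submodule.span ℝ (insert D.a (rowA '' J)))ᗮ).starProjection}

/-! ### The semismooth Newton method -/

/-- The generalized Hessian `Q + σ Q P Q`. -/
def newtonOp (σ : ℝ) (P : E n →L[ℝ] E n) : E n →L[ℝ] E n :=
  D.Qop + σ • (D.Qop ∘L P ∘L D.Qop)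

/-- `dir` is an admissible inexact Newton direction at `w`: for some element `P` of the HS-Jacobian
at `u(w)` and `M = Q + σ Q P Q`, it is an iterate of the conjugate gradient method (started at `0`)
for `M dir = -∇ψ(w)`, lies in `Ran(Q)`, and satisfies
`‖M dir + ∇ψ(w)‖ ≤ min(η, ‖∇ψ(w)‖^(1+τ))`. -/
def IsNewtonDirection (x : E n) (σ τ η : ℝ) (w dir : E n) : Prop :=
  ∃ P ∈ D.hsJacobian (D.uArg x σ w),
    (∃ i, dir = (cgIter (D.newtonOp σ P) (-gradient (D.psi x σ) w) i).sol) ∧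
    dir ∈ D.ranQ ∧
    ‖D.newtonOp σ P dir + gradient (D.psi x σ) w‖
      ≤ min η (‖gradient (D.psi x σ) w‖ ^ (1 + τ))

/-- The line search condition
`ψ(w + δ^m dir) ≤ ψ(w) + μ δ^m ⟨∇ψ(w), dir⟩`. -/
def LineSearchCond (x : E n) (σ μ δ : ℝ) (w dir : E n) (m : ℕ) : Prop :=
  D.psi x σ (w + δ ^ m • dir)
    ≤ D.psi x σ w + μ * δ ^ m * inner ℝ (gradient (D.psi x σ) w) dir

/-- `w` is an infinite sequence generated by the semismooth Newton method for
`min {ψ(w) | w ∈ Ran(Q)}`. -/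
def IsSsNSequence (x : E n) (σ μ δ τ η : ℝ) (w : ℕ → E n) : Prop :=
  w 0 ∈ D.ranQ ∧
  ∀ j, ∃ dir : E n, ∃ m : ℕ,
    D.IsNewtonDirection x σ τ η (w j) dir ∧
    IsLeast {k : ℕ | D.LineSearchCond x σ μ δ (w j) dir k} m ∧
    w (j + 1) = w j + δ ^ m • dir

end QPData

end SsN

end

/-!
Let `Π` be the projector onto `K ∩ L`, a compact convex set. Moreau's identity
(`isLeast_supportFn_add`) evaluates the infimum defining `ψ`: up to a constant,
`ψ(w) = ½⟨w, Qw⟩ + φ(u(w)) / σ`, where `φ(v) = ⟨v, Π(v)⟩ - ½‖Π(v)‖²` is a potential of `Π`. Hence `ψ`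
is differentiable with Lipschitz gradient `Q(w - Π(u(w)))`, and since `Q` is positive definite on its
range (`exists_coercive`), `ψ` is strongly convex on `Ran(Q)`.

Global convergence. Every `M = Q + σQPQ` satisfies `α‖d‖² ≤ ⟨d, Md⟩` on `Ran(Q)` and
`⟨d, Md⟩ ≤ β‖d‖²`, with `α`, `β` independent of `P`. The energy `½⟨d, Md⟩ - ⟨b, d⟩` decreases along
the conjugate gradient iterates, and the first of them is a steepest descent step; this alone gives
`⟨b, d⟩ ≥ ‖b‖² / (2β)` and `‖d‖ ≤ 2‖b‖ / α` for all iterates but the zeroth (`cgIter_succ_descent`),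
without conjugacy of the search directions. As `η < 1`, the zeroth iterate meets the residual test
only at a stationary point. So the directions are gradient related, the step lengths are bounded
below (`lineSearch_decrease`), and the gradients tend to zero. Strong monotonicity of the gradient
then makes the sequence Cauchy, and its limit `wt` is the unique stationary point and minimizer.

Local rate. The HS-Jacobian is exact near any point `v₀`: `Π(v) - Π(v₀) = P(v - v₀)` for every `P` in
the HS-Jacobian at `v` (`eventually_hsJacobian_apply`). Consequently `∇ψ(w) = M(w - wt)` near `wt`, so
that `M(w + d - wt)` is the residual of the Newton system, of size at most
`‖∇ψ(w)‖^(1+τ) = O(‖w - wt‖^(1+τ))`. Moreover `ψ(w) - ψ(wt) ≥ ½⟨∇ψ(w), w - wt⟩`, so the line search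
with `μ < ½` eventually accepts the unit step (`eventually_newton_step`).
-/

namespace SsN

variable {n : ℕ}

/-! ### The projector onto a compact convex set and its potential -/

/-- The defining minimum is attained, and it is characterized by the variational inequality. -/
theorem proj_spec {S : Set (E n)} (hne : S.Nonempty) (hc : IsClosed S) (hconv : Convex ℝ S)
    (v : E n) : proj S v ∈ S ∧ ∀ y ∈ S, inner ℝ (v - proj S v) (y - proj S v) ≤ 0 := by
  have hex : ∃ p, p ∈ S ∧ ∀ y ∈ S, ‖p - v‖ ≤ ‖y - v‖ := by
    obtain ⟨p, hp, hpv⟩ := hc.exists_infDist_eq_dist hne v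
    refine ⟨p, hp, fun y hy => ?_⟩
    have := Metric.infDist_le_dist_of_mem (x := v) hy
    rw [hpv] at this
    simpa [dist_eq_norm, norm_sub_rev] using this
  obtain ⟨hmem, hmin⟩ := Classical.epsilon_spec hex
  change proj S v ∈ S at hmem
  change ∀ y ∈ S, ‖proj S v - v‖ ≤ ‖y - v‖ at hmin
  refine ⟨hmem, (norm_eq_iInf_iff_real_inner_le_zero hconv hmem).1 ?_⟩
  have : Nonempty S := ⟨⟨_, hmem⟩⟩
  refine le_antisymm (le_ciInf fun y => ?_)
    (ciInf_le ⟨0, by rintro _ ⟨y, rfl⟩; positivity⟩ (⟨_, hmem⟩ : S))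
  rw [norm_sub_rev, norm_sub_rev v]
  exact hmin y y.2

theorem norm_proj_sub_sq_le {S : Set (E n)} (hne : S.Nonempty) (hc : IsClosed S)
    (hconv : Convex ℝ S) (v v' : E n) :
    ‖proj S v - proj S v'‖ ^ 2 ≤ inner ℝ (proj S v - proj S v') (v - v') := by
  obtain ⟨h1, h2⟩ := proj_spec hne hc hconv v
  obtain ⟨h3, h4⟩ := proj_spec hne hc hconv v'
  have h5 := h2 _ h3
  have h6 := h4 _ h1
  rw [← real_inner_self_eq_norm_sq]
  generalize proj S v = p at *
  generalize proj S v' = q at *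
  simp only [inner_sub_left, inner_sub_right] at *
  linarith [real_inner_comm p q, real_inner_comm p v, real_inner_comm p v', real_inner_comm q v,
    real_inner_comm q v']

theorem norm_proj_sub_le {S : Set (E n)} (hne : S.Nonempty) (hc : IsClosed S)
    (hconv : Convex ℝ S) (v v' : E n) : ‖proj S v - proj S v'‖ ≤ ‖v - v'‖ := by
  have h := (norm_proj_sub_sq_le hne hc hconv v v').trans (real_inner_le_norm _ _)
  by_contra! hlt
  nlinarith [norm_nonneg (v - v')]

/-- The conjugate of `½‖·‖²` restricted to `S`, that is `v ↦ max_{y ∈ S} ⟨v, y⟩ - ½‖y‖²`; the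
maximum is attained at the projection of `v`, so this is a potential of the projector. -/
noncomputable def projPotential (S : Set (E n)) (v : E n) : ℝ :=
  inner ℝ v (proj S v) - 1 / 2 * ‖proj S v‖ ^ 2

theorem projPotential_sub (S : Set (E n)) (v v' : E n) :
    projPotential S v - projPotential S v' - inner ℝ (proj S v') (v - v')
      = -inner ℝ (v - proj S v) (proj S v' - proj S v) + 1 / 2 * ‖proj S v - proj S v'‖ ^ 2 := by
  simp only [projPotential, ← real_inner_self_eq_norm_sq]
  generalize proj S v = p
  generalize proj S v' = q
  simp only [inner_sub_left, inner_sub_right]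
  linarith [real_inner_comm p q, real_inner_comm q v, real_inner_comm q v']

theorem half_norm_proj_sub_sq_le {S : Set (E n)} (hne : S.Nonempty) (hc : IsClosed S)
    (hconv : Convex ℝ S) (v v' : E n) :
    1 / 2 * ‖proj S v - proj S v'‖ ^ 2
      ≤ projPotential S v - projPotential S v' - inner ℝ (proj S v') (v - v') := by
  rw [projPotential_sub]
  linarith [(proj_spec hne hc hconv v).2 _ (proj_spec hne hc hconv v').1]

theorem projPotential_sub_le {S : Set (E n)} (hne : S.Nonempty) (hc : IsClosed S)
    (hconv : Convex ℝ S) (v v' : E n) :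
    projPotential S v - projPotential S v' - inner ℝ (proj S v') (v - v')
      ≤ 1 / 2 * ‖v - v'‖ ^ 2 := by
  have h := half_norm_proj_sub_sq_le hne hc hconv v' v
  have h2 : 0 ≤ ‖(v - v') - (proj S v - proj S v')‖ ^ 2 := by positivity
  rw [norm_sub_sq_real] at h2
  rw [norm_sub_rev] at h
  have h3 : inner ℝ (proj S v) (v' - v) = -inner ℝ (v - v') (proj S v) := by
    rw [real_inner_comm, ← inner_neg_left, neg_sub]
  rw [inner_sub_right] at h2
  linarith [real_inner_comm (proj S v') (v - v')]

/-- Moreau's identity: the infimal convolution of the support function with a squared norm. -/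
theorem isLeast_supportFn_add {S : Set (E n)} (hne : S.Nonempty) (hS : IsCompact S)
    (hconv : Convex ℝ S) {σ : ℝ} (hσ : 0 < σ) (v : E n) :
    IsLeast (Set.range fun z : E n => supportFn S z + σ / 2 * ‖z - (1 / σ) • v‖ ^ 2)
      (1 / σ * projPotential S v) := by
  obtain ⟨hp, hvi⟩ := proj_spec hne hS.isClosed hconv v
  have : Nonempty S := ⟨⟨_, hp⟩⟩
  have key : ∀ z : E n, σ / 2 * ‖z - (1 / σ) • v‖ ^ 2 = σ / 2 * ‖z - (1 / σ) • (v - proj S v)‖ ^ 2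
      - inner ℝ z (proj S v) + 1 / σ * projPotential S v := by
    intro z
    simp only [projPotential, ← real_inner_self_eq_norm_sq, inner_sub_left, inner_sub_right,
      real_inner_smul_left, real_inner_smul_right]
    generalize proj S v = p
    rw [real_inner_comm z v, real_inner_comm z p, real_inner_comm p v]
    field_simp
    ring
  constructor
  · refine ⟨(1 / σ) • (v - proj S v), ?_⟩
    have hsup : supportFn S ((1 / σ) • (v - proj S v))
        = inner ℝ ((1 / σ) • (v - proj S v)) (proj S v) := by
      have hle : ∀ y : S, inner ℝ ((1 / σ) • (v - proj S v)) (y : E n)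
          ≤ inner ℝ ((1 / σ) • (v - proj S v)) (proj S v) := by
        intro y
        have := hvi y y.2
        rw [inner_sub_right] at this
        rw [real_inner_smul_left, real_inner_smul_left]
        exact mul_le_mul_of_nonneg_left (by linarith) (by positivity)
      exact le_antisymm (ciSup_le hle)
        (le_ciSup (f := fun y : S => inner ℝ ((1 / σ) • (v - proj S v)) (y : E n))
          ⟨_, by rintro _ ⟨y, rfl⟩; exact hle y⟩ ⟨_, hp⟩)
    simp only
    rw [key, hsup]
    simp
  · rintro _ ⟨z, rfl⟩
    have hsup : inner ℝ z (proj S v) ≤ supportFn S z := by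
      refine le_ciSup (f := fun y : S => inner ℝ z (y : E n)) ?_ ⟨_, hp⟩
      obtain ⟨B, hB⟩ := hS.bddAbove_image (f := fun y => inner ℝ z y) (by fun_prop)
      exact ⟨B, by rintro _ ⟨y, rfl⟩; exact hB ⟨y, y.2, rfl⟩⟩
    simp only
    rw [key]
    have : 0 ≤ σ / 2 * ‖z - (1 / σ) • (v - proj S v)‖ ^ 2 := by positivity
    linarith

namespace QPData

variable (D : QPData n)

/-! ### The gradient of `ψ` and strong convexity on the range of `Q` -/

theorem isClosed_feasible : IsClosed D.feasible := by
  refine IsClosed.inter ?_ (isClosed_eq (by fun_prop) continuous_const)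
  simp only [box, Set.ofPred_forall, Set.ofPred_and]
  exact isClosed_iInter fun i => (isClosed_le continuous_const (by fun_prop)).inter
    (isClosed_le (by fun_prop) continuous_const)

theorem convex_feasible : Convex ℝ D.feasible := by
  rintro y ⟨hy, hy'⟩ z ⟨hz, hz'⟩ s t hs ht hst
  refine ⟨fun i => ?_, ?_⟩
  · obtain ⟨h1, h2⟩ := hy i
    obtain ⟨h3, h4⟩ := hz i
    exact convex_Icc (D.l i) (D.u i) ⟨h1, h2⟩ ⟨h3, h4⟩ hs ht hst
  · simp only [hyperplane, Set.mem_ofPred_eq] at *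
    rw [inner_add_right, real_inner_smul_right, real_inner_smul_right, hy', hz', ← add_mul, hst,
      one_mul]

theorem isCompact_feasible : IsCompact D.feasible := by
  have hsub : D.feasible ⊆ WithLp.toLp 2 '' (Set.Icc D.l.ofLp D.u.ofLp) := fun y hy =>
    ⟨y.ofLp, ⟨fun i => (hy.1 i).1, fun i => (hy.1 i).2⟩, rfl⟩
  exact (isCompact_Icc.image (PiLp.continuous_toLp 2 _)).of_isClosed_subset
    D.isClosed_feasible hsub

/-- `Π(u(w))`. -/
noncomputable def projArg (x : E n) (σ : ℝ) (w : E n) : E n := proj D.feasible (D.uArg x σ w)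

/-- The gradient `Q (w - Π(u(w)))` of `ψ` at `w`. -/
noncomputable def psiGrad (x : E n) (σ : ℝ) (w : E n) : E n := D.Qop (w - D.projArg x σ w)

theorem psi_eq (hne : D.feasible.Nonempty) (x : E n) {σ : ℝ} (hσ : 0 < σ) (w : E n) :
    D.psi x σ w = 1 / 2 * inner ℝ w (D.Qop w)
      + 1 / σ * projPotential D.feasible (D.uArg x σ w) - 1 / (2 * σ) * ‖x‖ ^ 2 := by
  obtain ⟨⟨z₀, hz₀⟩, hlb⟩ :=
    isLeast_supportFn_add hne D.isCompact_feasible D.convex_feasible hσ (D.uArg x σ w)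
  have harg : ∀ z, D.Qop w + z + D.c - (1 / σ) • x = z - (1 / σ) • D.uArg x σ w := by
    intro z
    rw [uArg, smul_sub, smul_smul, one_div_mul_cancel hσ.ne', one_smul]
    abel
  have h : IsLeast (Set.range fun z => D.augLagrangian σ w z x)
      (1 / 2 * inner ℝ w (D.Qop w)
      + 1 / σ * projPotential D.feasible (D.uArg x σ w) - 1 / (2 * σ) * ‖x‖ ^ 2) := by
    constructor
    · refine ⟨z₀, ?_⟩
      simp only [augLagrangian] at *
      rw [harg]
      linarith
    · rintro _ ⟨z, rfl⟩
      have := hlb ⟨z, rfl⟩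
      simp only [augLagrangian] at *
      rw [harg]
      linarith
  exact h.csInf_eq

theorem isSymmetric_Qop (hQ : D.Q.PosSemidef) (v w : E n) :
    inner ℝ (D.Qop v) w = inner ℝ v (D.Qop w) :=
  (Matrix.isPositive_toEuclideanLin_iff.2 hQ).1 v w

theorem inner_Qop_nonneg (hQ : D.Q.PosSemidef) (w : E n) : 0 ≤ inner ℝ w (D.Qop w) := by
  rw [← D.isSymmetric_Qop hQ]
  exact (Matrix.isPositive_toEuclideanLin_iff.2 hQ).2 w

theorem uArg_sub (x : E n) (σ : ℝ) (w w' : E n) :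
    D.uArg x σ w - D.uArg x σ w' = -(σ • D.Qop (w - w')) := by
  simp only [uArg, map_sub, smul_sub, smul_add]
  abel

/-- The first-order expansion error of `ψ` is that of the quadratic part plus that of the
potential of the projector. -/
theorem psi_sub (hQ : D.Q.PosSemidef) (hne : D.feasible.Nonempty) (x : E n) {σ : ℝ} (hσ : 0 < σ)
    (w w' : E n) :
    D.psi x σ w' - D.psi x σ w - inner ℝ (D.psiGrad x σ w) (w' - w)
      = 1 / 2 * inner ℝ (w' - w) (D.Qop (w' - w))
        + 1 / σ * (projPotential D.feasible (D.uArg x σ w')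
          - projPotential D.feasible (D.uArg x σ w)
          - inner ℝ (D.projArg x σ w) (D.uArg x σ w' - D.uArg x σ w)) := by
  rw [D.psi_eq hne x hσ, D.psi_eq hne x hσ, uArg_sub, psiGrad, D.isSymmetric_Qop hQ,
    inner_neg_right, real_inner_smul_right]
  simp only [inner_sub_left, inner_sub_right, map_sub]
  rw [← D.isSymmetric_Qop hQ w w', real_inner_comm (D.Qop w) w']
  field_simp
  ring

theorem psi_sub_le (hQ : D.Q.PosSemidef) (hne : D.feasible.Nonempty) (x : E n) {σ : ℝ}
    (hσ : 0 < σ) (w w' : E n) :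
    D.psi x σ w' - D.psi x σ w - inner ℝ (D.psiGrad x σ w) (w' - w)
      ≤ 1 / 2 * (‖D.Qop‖ + σ * ‖D.Qop‖ ^ 2) * ‖w' - w‖ ^ 2 := by
  rw [D.psi_sub hQ hne x hσ]
  have h1 := projPotential_sub_le hne D.isClosed_feasible D.convex_feasible (D.uArg x σ w')
    (D.uArg x σ w)
  have hb := D.Qop.le_opNorm (w' - w)
  have h2 : inner ℝ (w' - w) (D.Qop (w' - w)) ≤ ‖D.Qop‖ * ‖w' - w‖ ^ 2 :=
    (real_inner_le_norm _ _).trans (by nlinarith [norm_nonneg (w' - w)])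
  have h3 : 1 / 2 * ‖D.uArg x σ w' - D.uArg x σ w‖ ^ 2
      ≤ σ * (1 / 2 * σ * ‖D.Qop‖ ^ 2 * ‖w' - w‖ ^ 2) := by
    rw [uArg_sub, norm_neg, norm_smul, Real.norm_of_nonneg hσ.le]
    have := pow_le_pow_left₀ (norm_nonneg _) hb 2
    nlinarith [mul_le_mul_of_nonneg_left this (by positivity : 0 ≤ 1 / 2 * σ ^ 2)]
  have h4 := mul_le_mul_of_nonneg_left (h1.trans h3) (by positivity : 0 ≤ 1 / σ)
  rw [← mul_assoc (1 / σ) σ, one_div_mul_cancel hσ.ne', one_mul] at h4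
  change _ * (_ - inner ℝ (D.projArg x σ w) _) ≤ _ at h4
  linarith

theorem le_psi_sub (hQ : D.Q.PosSemidef) (hne : D.feasible.Nonempty) (x : E n) {σ : ℝ}
    (hσ : 0 < σ) (w w' : E n) :
    1 / 2 * inner ℝ (w' - w) (D.Qop (w' - w))
        + 1 / σ * (1 / 2 * ‖D.projArg x σ w' - D.projArg x σ w‖ ^ 2)
      ≤ D.psi x σ w' - D.psi x σ w - inner ℝ (D.psiGrad x σ w) (w' - w) := by
  rw [D.psi_sub hQ hne x hσ]
  have := mul_le_mul_of_nonneg_left (half_norm_proj_sub_sq_le hne D.isClosed_feasible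
    D.convex_feasible (D.uArg x σ w') (D.uArg x σ w)) (by positivity : 0 ≤ 1 / σ)
  simp only [projArg]
  linarith

theorem hasGradientAt_psi (hQ : D.Q.PosSemidef) (hne : D.feasible.Nonempty) (x : E n) {σ : ℝ}
    (hσ : 0 < σ) (w : E n) : HasGradientAt (D.psi x σ) (D.psiGrad x σ w) w := by
  rw [hasGradientAt_iff_isLittleO]
  refine IsBigO.trans_isLittleO (g := fun w' => ‖w' - w‖ ^ 2) ?_ ?_
  · refine IsBigO.of_bound (1 / 2 * (‖D.Qop‖ + σ * ‖D.Qop‖ ^ 2)) (Eventually.of_forall fun w' => ?_)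
    have h1 := D.psi_sub_le hQ hne x hσ w w'
    have h2 := D.le_psi_sub hQ hne x hσ w w'
    have h3 := D.inner_Qop_nonneg hQ (w' - w)
    have h4 : 0 ≤ 1 / σ * (1 / 2 * ‖D.projArg x σ w' - D.projArg x σ w‖ ^ 2) := by positivity
    rw [Real.norm_of_nonneg (by linarith), Real.norm_of_nonneg (by positivity)]
    exact h1
  · exact isLittleO_pow_sub_sub w one_lt_two

theorem gradient_psi (hQ : D.Q.PosSemidef) (hne : D.feasible.Nonempty) (x : E n) {σ : ℝ}
    (hσ : 0 < σ) (w : E n) : gradient (D.psi x σ) w = D.psiGrad x σ w :=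
  (D.hasGradientAt_psi hQ hne x hσ w).gradient

theorem norm_psiGrad_sub_le (hne : D.feasible.Nonempty) (x : E n) {σ : ℝ} (hσ : 0 < σ)
    (w w' : E n) :
    ‖D.psiGrad x σ w - D.psiGrad x σ w'‖ ≤ (‖D.Qop‖ + σ * ‖D.Qop‖ ^ 2) * ‖w - w'‖ := by
  have h1 : D.psiGrad x σ w - D.psiGrad x σ w'
      = D.Qop (w - w') - D.Qop (D.projArg x σ w - D.projArg x σ w') := by
    simp only [psiGrad, map_sub]
    abel
  have h2 : ‖D.projArg x σ w - D.projArg x σ w'‖ ≤ σ * (‖D.Qop‖ * ‖w - w'‖) := by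
    refine (norm_proj_sub_le hne D.isClosed_feasible D.convex_feasible _ _).trans ?_
    rw [uArg_sub, norm_neg, norm_smul, Real.norm_of_nonneg hσ.le]
    exact mul_le_mul_of_nonneg_left (D.Qop.le_opNorm _) hσ.le
  rw [h1]
  refine (norm_sub_le _ _).trans ?_
  have h3 := (D.Qop.le_opNorm (D.projArg x σ w - D.projArg x σ w')).trans
    (mul_le_mul_of_nonneg_left h2 (norm_nonneg _))
  linarith [D.Qop.le_opNorm (w - w')]

/-- `Q` is positive definite on its range. -/
theorem exists_coercive (hQ : D.Q.PosSemidef) :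
    ∃ α : ℝ, 0 < α ∧ ∀ w ∈ D.ranQ, α * ‖w‖ ^ 2 ≤ inner ℝ w (D.Qop w) := by
  -- a quantitative form of `⟨w, Qw⟩ = 0 → Qw = 0`
  have hcs : ∀ w, ‖D.Qop w‖ ^ 2 ≤ (‖D.Qop‖ + 1) * inner ℝ w (D.Qop w) := by
    intro w
    have hβ : 0 < ‖D.Qop‖ + 1 := by positivity
    have h := D.inner_Qop_nonneg hQ ((‖D.Qop‖ + 1) • w - D.Qop w)
    have h2 : inner ℝ (D.Qop w) (D.Qop (D.Qop w)) ≤ (‖D.Qop‖ + 1) * ‖D.Qop w‖ ^ 2 :=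
      (real_inner_le_norm _ _).trans (by
        nlinarith [D.Qop.le_opNorm (D.Qop w), norm_nonneg (D.Qop w), sq_nonneg ‖D.Qop w‖])
    simp only [map_sub, map_smul, inner_sub_left, inner_sub_right, real_inner_smul_left,
      real_inner_smul_right] at h
    rw [← D.isSymmetric_Qop hQ w (D.Qop w), real_inner_self_eq_norm_sq] at h
    have h5 : (‖D.Qop‖ + 1) * ‖D.Qop w‖ ^ 2
        ≤ (‖D.Qop‖ + 1) * ((‖D.Qop‖ + 1) * inner ℝ w (D.Qop w)) := by linarith
    exact le_of_mul_le_mul_left h5 hβ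
  have hinj : LinearMap.ker ((D.Qop : E n →ₗ[ℝ] E n).domRestrict D.ranQ) = ⊥ := by
    rw [LinearMap.ker_eq_bot']
    rintro ⟨w, v, rfl⟩ h
    have h' : D.Qop (D.Qop v) = 0 := h
    have : inner ℝ (D.Qop v) (D.Qop v) = 0 := by
      rw [D.isSymmetric_Qop hQ, h', inner_zero_right]
    exact Subtype.ext (inner_self_eq_zero.1 this)
  obtain ⟨K, hK, hanti⟩ := LinearMap.exists_antilipschitzWith _ hinj
  refine ⟨1 / (K ^ 2 * (‖D.Qop‖ + 1)), by positivity, fun w hw => ?_⟩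
  have h1 : ‖w‖ ≤ K * ‖D.Qop w‖ := by
    have := hanti.le_mul_dist ⟨w, hw⟩ 0
    simpa [dist_eq_norm] using this
  have h2 := pow_le_pow_left₀ (norm_nonneg _) h1 2
  rw [div_mul_eq_mul_div, one_mul, div_le_iff₀ (by positivity)]
  nlinarith [mul_le_mul_of_nonneg_left (hcs w) (by positivity : (0 : ℝ) ≤ (K : ℝ) ^ 2)]

theorem psiGrad_mem_ranQ (x : E n) (σ : ℝ) (w : E n) : D.psiGrad x σ w ∈ D.ranQ := ⟨_, rfl⟩

end QPData

/-! ### Descent properties of conjugate gradient iterates -/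

/-- The energy `½⟨d, M d⟩ - ⟨b, d⟩`, whose minimizer solves `M d = b`. -/
noncomputable def cgEnergy (M : E n →L[ℝ] E n) (b d : E n) : ℝ :=
  1 / 2 * inner ℝ d (M d) - inner ℝ b d

section CG

variable {M : E n →L[ℝ] E n} {S : Submodule ℝ (E n)} {α β : ℝ} {b : E n}

/-- The step length of the conjugate gradient method satisfies its defining equation also when the
denominator vanishes, since the residual then vanishes too. -/
theorem cg_stepLength_mul (hα : 0 < α) (hlow : ∀ v ∈ S, α * ‖v‖ ^ 2 ≤ inner ℝ v (M v))
    {r p : E n} (hp : p ∈ S) (hrp : inner ℝ r p = inner ℝ r r) :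
    inner ℝ r r / inner ℝ p (M p) * inner ℝ p (M p) = inner ℝ r r := by
  by_cases h : inner ℝ p (M p) = 0
  · have h1 := hlow p hp
    have hp0 : p = 0 := by
      by_contra hne
      have : 0 < ‖p‖ := norm_pos_iff.2 hne
      have : 0 < α * ‖p‖ ^ 2 := by positivity
      linarith
    rw [h, mul_zero, ← hrp, hp0, inner_zero_right]
  · exact div_mul_cancel₀ _ h

/-- The two identities `r = b - M d` and `⟨r, p⟩ = ⟨r, r⟩` between current solution `d`, residual
`r` and search direction `p`. -/
theorem cgIter_invariant (hsym : ∀ v w, inner ℝ (M v) w = inner ℝ v (M w))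
    (hmap : ∀ v ∈ S, M v ∈ S) (hα : 0 < α) (hlow : ∀ v ∈ S, α * ‖v‖ ^ 2 ≤ inner ℝ v (M v))
    (hb : b ∈ S) (i : ℕ) :
    (cgIter M b i).sol ∈ S ∧ (cgIter M b i).res ∈ S ∧ (cgIter M b i).dir ∈ S ∧
      (cgIter M b i).res = b - M (cgIter M b i).sol ∧
      inner ℝ (cgIter M b i).res (cgIter M b i).dir
        = inner ℝ (cgIter M b i).res (cgIter M b i).res := by
  induction i with
  | zero => exact ⟨S.zero_mem, hb, hb, by simp [cgIter], rfl⟩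
  | succ i ih =>
    simp only [cgIter]
    obtain ⟨h1, h2, h3, h4, h5⟩ := ih
    generalize cgIter M b i = s at *
    have hstep := cg_stepLength_mul hα hlow h3 h5
    simp only [cgStep]
    generalize inner ℝ s.res s.res / inner ℝ s.dir (M s.dir) = a at *
    have hr : s.res - a • M s.dir ∈ S := S.sub_mem h2 (S.smul_mem _ (hmap _ h3))
    have horth : inner ℝ (s.res - a • M s.dir) s.dir = 0 := by
      rw [inner_sub_left, real_inner_smul_left, hsym, hstep, h5, sub_self]
    refine ⟨S.add_mem h1 (S.smul_mem _ h3), hr, S.add_mem hr (S.smul_mem _ h3), ?_, ?_⟩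
    · rw [map_add, map_smul, h4]
      abel
    · rw [inner_add_right, real_inner_smul_right, horth, mul_zero, add_zero]

theorem cgEnergy_succ (hsym : ∀ v w, inner ℝ (M v) w = inner ℝ v (M w))
    (hmap : ∀ v ∈ S, M v ∈ S) (hα : 0 < α) (hlow : ∀ v ∈ S, α * ‖v‖ ^ 2 ≤ inner ℝ v (M v))
    (hb : b ∈ S) (i : ℕ) :
    cgEnergy M b (cgIter M b (i + 1)).sol = cgEnergy M b (cgIter M b i).sol
      - 1 / 2 * (inner ℝ (cgIter M b i).res (cgIter M b i).res
          / inner ℝ (cgIter M b i).dir (M (cgIter M b i).dir))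
        * inner ℝ (cgIter M b i).res (cgIter M b i).res := by
  obtain ⟨h1, h2, h3, h4, h5⟩ := cgIter_invariant hsym hmap hα hlow hb i
  simp only [cgIter]
  generalize cgIter M b i = s at *
  have hstep := cg_stepLength_mul hα hlow h3 h5
  simp only [cgStep]
  generalize inner ℝ s.res s.res / inner ℝ s.dir (M s.dir) = a at *
  have h6 : inner ℝ b s.dir = inner ℝ s.res s.res + inner ℝ s.sol (M s.dir) := by
    rw [← h5, h4, inner_sub_left, hsym]
    ring
  have h7 : inner ℝ s.dir (M s.sol) = inner ℝ s.sol (M s.dir) := by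
    rw [← hsym, real_inner_comm]
  simp only [cgEnergy, map_add, map_smul, inner_add_left, inner_add_right, real_inner_smul_left,
    real_inner_smul_right]
  rw [h6, h7]
  linear_combination 1 / 2 * a * hstep

/-- After at least one step, the energy is at most the one reached by a steepest descent step. -/
theorem cgEnergy_le (hsym : ∀ v w, inner ℝ (M v) w = inner ℝ v (M w))
    (hmap : ∀ v ∈ S, M v ∈ S) (hα : 0 < α) (hlow : ∀ v ∈ S, α * ‖v‖ ^ 2 ≤ inner ℝ v (M v))
    (hβ : 0 < β) (hup : ∀ v, inner ℝ v (M v) ≤ β * ‖v‖ ^ 2) (hb : b ∈ S) (i : ℕ) :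
    cgEnergy M b (cgIter M b (i + 1)).sol ≤ -(1 / (2 * β) * ‖b‖ ^ 2) := by
  induction i with
  | zero =>
    rw [cgEnergy_succ hsym hmap hα hlow hb]
    simp only [cgIter, cgEnergy, real_inner_self_eq_norm_sq, map_zero, inner_zero_right]
    rcases eq_or_ne b 0 with rfl | hne
    · simp
    have hpos : 0 < ‖b‖ ^ 2 := by have := norm_pos_iff.2 hne; positivity
    have hM : 0 < inner ℝ b (M b) := lt_of_lt_of_le (by positivity) (hlow b hb)
    have h1 : 1 / β ≤ ‖b‖ ^ 2 / inner ℝ b (M b) := by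
      rw [div_le_div_iff₀ hβ hM]
      linarith [hup b]
    have h2 := mul_le_mul_of_nonneg_right h1 hpos.le
    have h3 : 1 / (2 * β) * ‖b‖ ^ 2 = 1 / 2 * (1 / β * ‖b‖ ^ 2) := by field_simp
    rw [h3]
    linarith
  | succ i ih =>
    rw [cgEnergy_succ hsym hmap hα hlow hb]
    have hdir := (cgIter_invariant hsym hmap hα hlow hb (i + 1)).2.2.1
    generalize cgIter M b (i + 1) = s at *
    have hM : 0 ≤ inner ℝ s.dir (M s.dir) := le_trans (by positivity) (hlow _ hdir)
    have : 0 ≤ 1 / 2 * (inner ℝ s.res s.res / inner ℝ s.dir (M s.dir)) * inner ℝ s.res s.res := by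
      have := real_inner_self_nonneg (x := s.res)
      positivity
    linarith

/-- Conjugate gradient iterates are uniformly gradient related. -/
theorem cgIter_succ_descent (hsym : ∀ v w, inner ℝ (M v) w = inner ℝ v (M w))
    (hmap : ∀ v ∈ S, M v ∈ S) (hα : 0 < α) (hlow : ∀ v ∈ S, α * ‖v‖ ^ 2 ≤ inner ℝ v (M v))
    (hβ : 0 < β) (hup : ∀ v, inner ℝ v (M v) ≤ β * ‖v‖ ^ 2) (hb : b ∈ S) (i : ℕ) :
    1 / (2 * β) * ‖b‖ ^ 2 ≤ inner ℝ b (cgIter M b (i + 1)).sol ∧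
      ‖(cgIter M b (i + 1)).sol‖ ≤ 2 / α * ‖b‖ := by
  have h1 := cgEnergy_le hsym hmap hα hlow hβ hup hb i
  have h2 := hlow _ (cgIter_invariant hsym hmap hα hlow hb (i + 1)).1
  generalize (cgIter M b (i + 1)).sol = d at *
  simp only [cgEnergy] at h1
  have h3 : 0 ≤ α * ‖d‖ ^ 2 := by positivity
  have h4 : 0 ≤ 1 / (2 * β) * ‖b‖ ^ 2 := by positivity
  refine ⟨by linarith, ?_⟩
  have h5 : α * ‖d‖ ^ 2 ≤ 2 * (‖b‖ * ‖d‖) := by linarith [real_inner_le_norm b d]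
  rw [div_mul_eq_mul_div, le_div_iff₀ hα]
  by_contra! hlt
  rcases (norm_nonneg d).eq_or_lt with h0 | h0
  · rw [← h0] at hlt
    linarith [norm_nonneg b]
  · nlinarith

end CG

namespace QPData

variable (D : QPData n)

/-! ### Exactness of the HS-Jacobian -/

theorem continuous_proj (hne : D.feasible.Nonempty) : Continuous (proj D.feasible) :=
  (LipschitzWith.of_dist_le_mul (K := 1) fun v v' => by
    simpa [dist_eq_norm] using
      norm_proj_sub_le hne D.isClosed_feasible D.convex_feasible v v').continuous

theorem eventually_activeSet_subset (hne : D.feasible.Nonempty) (v₀ : E n) :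
    ∀ᶠ v in 𝓝 v₀, D.activeSet v ⊆ D.activeSet v₀ := by
  have h : ∀ᶠ v in 𝓝 v₀, ∀ i, i ∈ D.activeSet v → i ∈ D.activeSet v₀ := by
    rw [eventually_all]
    intro i
    by_cases hi : i ∈ D.activeSet v₀
    · exact Eventually.of_forall fun _ _ => hi
    · have hcont : Continuous fun v => inner ℝ (rowA i) (proj D.feasible v) :=
        continuous_const.inner (D.continuous_proj hne)
      exact (hcont.continuousAt.eventually_ne hi).mono fun v hv hv' => absurd hv' hv
  exact h.mono fun v hv i => hv i

theorem proj_sub_mem_span {v : E n} {J : Set (Fin n ⊕ Fin n)} (hJ : J ∈ D.basisSets v) :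
    proj D.feasible v - v ∈ Submodule.span ℝ (insert D.a (rowA '' J)) := by
  obtain ⟨⟨lam, m, ⟨hstat, -, -⟩, hsupp⟩, -⟩ := hJ
  have h : proj D.feasible v - v = ∑ i, lam i • rowA i + m • D.a := by
    rw [← sub_eq_zero, ← hstat]
    abel
  rw [h]
  refine Submodule.add_mem _ (Submodule.sum_mem _ fun i _ => ?_)
    (Submodule.smul_mem _ _ (Submodule.subset_span (Set.mem_insert _ _)))
  by_cases hi : lam i = 0
  · rw [hi, zero_smul]
    exact Submodule.zero_mem _
  · exact Submodule.smul_mem _ _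
      (Submodule.subset_span (Set.mem_insert_of_mem _ ⟨i, hsupp hi, rfl⟩))

/-- A row set usable at points arbitrarily close to `v₀` also carries the normal vector at `v₀`,
since there are finitely many row sets and their spans are closed. -/
theorem eventually_proj_sub_mem_span (hne : D.feasible.Nonempty) (v₀ : E n) :
    ∀ᶠ v in 𝓝 v₀, ∀ J ∈ D.basisSets v,
      proj D.feasible v₀ - v₀ ∈ Submodule.span ℝ (insert D.a (rowA '' J)) := by
  rw [eventually_all]
  intro J
  by_cases hmem : proj D.feasible v₀ - v₀ ∈ Submodule.span ℝ (insert D.a (rowA '' J))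
  · exact Eventually.of_forall fun _ _ => hmem
  · have hcl : IsClosed (Submodule.span ℝ (insert D.a (rowA '' J)) : Set (E n)) :=
      Submodule.closed_of_finiteDimensional _
    have hcont : Continuous fun v => proj D.feasible v - v :=
      (D.continuous_proj hne).sub continuous_id
    exact (hcont.continuousAt.eventually (hcl.isOpen_compl.mem_nhds hmem)).mono
      fun v hv hJ => absurd (D.proj_sub_mem_span hJ) hv

/-- Near `v₀`, every element of the HS-Jacobian at `v` maps `v - v₀` exactly to `Π(v) - Π(v₀)`:
this difference lies in the kernel of the active rows, while the normal vectors `Π(v) - v` and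
`Π(v₀) - v₀` lie in their span. -/
theorem eventually_hsJacobian_apply (hne : D.feasible.Nonempty) (v₀ : E n) :
    ∀ᶠ v in 𝓝 v₀, ∀ P ∈ D.hsJacobian v,
      P (v - v₀) = proj D.feasible v - proj D.feasible v₀ := by
  filter_upwards [D.eventually_activeSet_subset hne v₀, D.eventually_proj_sub_mem_span hne v₀]
    with v hact hspan
  rintro P ⟨J, hJ, rfl⟩
  apply Submodule.eq_starProjection_of_mem_orthogonal
  · rw [Submodule.mem_orthogonal]
    intro y hy
    induction hy using Submodule.span_induction with
    | mem y hy =>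
      have hL := (proj_spec hne D.isClosed_feasible D.convex_feasible v).1.2
      have hL₀ := (proj_spec hne D.isClosed_feasible D.convex_feasible v₀).1.2
      rw [inner_sub_right]
      rcases hy with rfl | ⟨i, hi, rfl⟩
      · exact sub_eq_zero.2 (Eq.trans hL (Eq.symm hL₀))
      · have h1 : inner ℝ (rowA i) (proj D.feasible v) = D.rhsG i := hJ.2.1 hi
        have h2 : inner ℝ (rowA i) (proj D.feasible v₀) = D.rhsG i := hact (hJ.2.1 hi)
        rw [h1, h2, sub_self]
    | zero => exact inner_zero_left _
    | add y z _ _ hy hz => rw [inner_add_left, hy, hz, add_zero]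
    | smul t y _ hy => rw [real_inner_smul_left, hy, mul_zero]
  · rw [Submodule.orthogonal_orthogonal]
    have h := Submodule.sub_mem _ (hspan J hJ) (D.proj_sub_mem_span hJ)
    convert h using 1
    abel

/-! ### The generalized Hessian -/

theorem hsJacobian_inner_comm {v : E n} {P : E n →L[ℝ] E n} (hP : P ∈ D.hsJacobian v) (y z : E n) :
    inner ℝ (P y) z = inner ℝ y (P z) := by
  obtain ⟨J, -, rfl⟩ := hP
  exact Submodule.inner_starProjection_left_eq_right _ _ _

theorem hsJacobian_inner_nonneg {v : E n} {P : E n →L[ℝ] E n} (hP : P ∈ D.hsJacobian v)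
    (y : E n) : 0 ≤ inner ℝ y (P y) := by
  obtain ⟨J, -, rfl⟩ := hP
  rw [real_inner_comm]
  exact Submodule.re_inner_starProjection_nonneg (Submodule.span ℝ (insert D.a (rowA '' J)))ᗮ y

theorem hsJacobian_norm_le {v : E n} {P : E n →L[ℝ] E n} (hP : P ∈ D.hsJacobian v) (y : E n) :
    ‖P y‖ ≤ ‖y‖ := by
  obtain ⟨J, -, rfl⟩ := hP
  exact Submodule.norm_starProjection_apply_le _ y

theorem newtonOp_apply (σ : ℝ) (P : E n →L[ℝ] E n) (y : E n) :
    D.newtonOp σ P y = D.Qop (y + σ • P (D.Qop y)) := by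
  simp [newtonOp]

theorem newtonOp_inner_comm (hQ : D.Q.PosSemidef) (σ : ℝ) {v : E n} {P : E n →L[ℝ] E n}
    (hP : P ∈ D.hsJacobian v) (y z : E n) :
    inner ℝ (D.newtonOp σ P y) z = inner ℝ y (D.newtonOp σ P z) := by
  rw [newtonOp_apply, newtonOp_apply, D.isSymmetric_Qop hQ, ← D.isSymmetric_Qop hQ y,
    inner_add_left, inner_add_right, real_inner_smul_left, real_inner_smul_right,
    D.hsJacobian_inner_comm hP, D.isSymmetric_Qop hQ y, D.isSymmetric_Qop hQ y]

theorem inner_newtonOp (hQ : D.Q.PosSemidef) (σ : ℝ) (P : E n →L[ℝ] E n) (y : E n) :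
    inner ℝ y (D.newtonOp σ P y)
      = inner ℝ y (D.Qop y) + σ * inner ℝ (D.Qop y) (P (D.Qop y)) := by
  rw [newtonOp_apply, ← D.isSymmetric_Qop hQ, inner_add_right, real_inner_smul_right,
    D.isSymmetric_Qop hQ]

theorem inner_Qop_le_inner_newtonOp (hQ : D.Q.PosSemidef) {σ : ℝ} (hσ : 0 < σ) {v : E n}
    {P : E n →L[ℝ] E n} (hP : P ∈ D.hsJacobian v) (y : E n) :
    inner ℝ y (D.Qop y) ≤ inner ℝ y (D.newtonOp σ P y) := by
  rw [D.inner_newtonOp hQ]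
  have := mul_nonneg hσ.le (D.hsJacobian_inner_nonneg hP (D.Qop y))
  linarith

theorem inner_newtonOp_le (hQ : D.Q.PosSemidef) {σ : ℝ} (hσ : 0 < σ) {v : E n}
    {P : E n →L[ℝ] E n} (hP : P ∈ D.hsJacobian v) (y : E n) :
    inner ℝ y (D.newtonOp σ P y) ≤ (‖D.Qop‖ + σ * ‖D.Qop‖ ^ 2) * ‖y‖ ^ 2 := by
  rw [D.inner_newtonOp hQ]
  have h0 := D.Qop.le_opNorm y
  have h1 : inner ℝ y (D.Qop y) ≤ ‖D.Qop‖ * ‖y‖ ^ 2 :=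
    (real_inner_le_norm _ _).trans (by nlinarith [norm_nonneg y])
  have h2 : inner ℝ (D.Qop y) (P (D.Qop y)) ≤ (‖D.Qop‖ * ‖y‖) ^ 2 := by
    rw [sq]
    exact (real_inner_le_norm _ _).trans (mul_le_mul h0
      ((D.hsJacobian_norm_le hP _).trans h0) (norm_nonneg _) (by positivity))
  nlinarith [mul_le_mul_of_nonneg_left h2 hσ.le]

theorem newtonOp_mem_ranQ (σ : ℝ) (P : E n →L[ℝ] E n) (y : E n) : D.newtonOp σ P y ∈ D.ranQ := by
  rw [newtonOp_apply]
  exact ⟨_, rfl⟩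

end QPData

/-! ### Global convergence -/

/-- Backtracking along a gradient related direction decreases the function by a fixed multiple of
the squared gradient norm, because the accepted step length is bounded below. -/
theorem lineSearch_decrease {f : E n → ℝ} {w g d : E n} {β c C μ δ : ℝ} (hβ : 0 < β) (hc : 0 < c)
    (hC : 0 < C) (hμ : μ ∈ Set.Ioo (0 : ℝ) (1 / 2)) (hδ : δ ∈ Set.Ioo (0 : ℝ) 1)
    (hub : ∀ t : ℝ, f (w + t • d) ≤ f w + t * inner ℝ g d + 1 / 2 * β * (t ^ 2 * ‖d‖ ^ 2))
    (hdesc : c * ‖g‖ ^ 2 ≤ -inner ℝ g d) (hd : ‖d‖ ≤ C * ‖g‖) {m : ℕ}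
    (hm : IsLeast {k : ℕ | f (w + δ ^ k • d) ≤ f w + μ * δ ^ k * inner ℝ g d} m) :
    f (w + δ ^ m • d) ≤ f w - μ * c * min 1 (δ * (c / (β * C ^ 2))) * ‖g‖ ^ 2 := by
  obtain ⟨hμ0, hμ1⟩ := hμ
  obtain ⟨hδ0, hδ1⟩ := hδ
  have hg0 : 0 ≤ ‖g‖ ^ 2 := by positivity
  have hstep : min 1 (δ * (c / (β * C ^ 2))) * ‖g‖ ^ 2 ≤ δ ^ m * ‖g‖ ^ 2 := by
    rcases m with _ | k
    · exact mul_le_mul_of_nonneg_right (by simp) hg0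
    · -- the step length `δ ^ k` was rejected
      have hk : ¬f (w + δ ^ k • d) ≤ f w + μ * δ ^ k * inner ℝ g d := fun h =>
        absurd (hm.2 h) (by omega)
      push Not at hk
      have ht : 0 < δ ^ k := by positivity
      have h1 := hub (δ ^ k)
      have h2 : ‖d‖ ^ 2 ≤ C ^ 2 * ‖g‖ ^ 2 := by
        rw [← mul_pow]
        exact pow_le_pow_left₀ (norm_nonneg _) hd 2
      -- rejection against the quadratic upper bound forces `δ ^ k` to be bounded below
      have h3 : (1 - μ) * -inner ℝ g d ≤ 1 / 2 * β * (δ ^ k * ‖d‖ ^ 2) := by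
        refine le_of_mul_le_mul_left ?_ ht
        linear_combination h1 + hk
      have h4 : c * ‖g‖ ^ 2 ≤ δ ^ k * (β * C ^ 2) * ‖g‖ ^ 2 := by
        have h5 : 0 ≤ -inner ℝ g d := le_trans (by positivity) hdesc
        have h6 := mul_le_mul_of_nonneg_left h2 (by positivity : 0 ≤ β * δ ^ k)
        nlinarith
      have h7 : c / (β * C ^ 2) * ‖g‖ ^ 2 ≤ δ ^ k * ‖g‖ ^ 2 := by
        rw [div_mul_eq_mul_div, div_le_iff₀ (by positivity)]
        linarith
      calc min 1 (δ * (c / (β * C ^ 2))) * ‖g‖ ^ 2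
          ≤ δ * (c / (β * C ^ 2)) * ‖g‖ ^ 2 := mul_le_mul_of_nonneg_right (min_le_right _ _) hg0
        _ = δ * (c / (β * C ^ 2) * ‖g‖ ^ 2) := by ring
        _ ≤ δ * (δ ^ k * ‖g‖ ^ 2) := mul_le_mul_of_nonneg_left h7 hδ0.le
        _ = δ ^ (k + 1) * ‖g‖ ^ 2 := by ring
  have h8 := mul_le_mul_of_nonneg_left hdesc (by positivity : 0 ≤ μ * δ ^ m)
  have h9 := mul_le_mul_of_nonneg_left hstep (by positivity : 0 ≤ μ * c)
  have h10 : f (w + δ ^ m • d) ≤ f w + μ * δ ^ m * inner ℝ g d := hm.1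
  linarith

/-- A sequence bounded below that decreases by at least `κ a_j²` in step `j` forces `a_j → 0`. -/
theorem tendsto_zero_of_sufficient_decrease {f a : ℕ → ℝ} {κ B : ℝ} (hκ : 0 < κ)
    (ha : ∀ j, 0 ≤ a j) (hB : ∀ j, B ≤ f j) (hf : ∀ j, f (j + 1) ≤ f j - κ * a j ^ 2) :
    Tendsto a atTop (𝓝 0) := by
  have hanti : Antitone f := antitone_nat_of_succ_le fun j => by
    have : 0 ≤ κ * a j ^ 2 := by positivity
    linarith [hf j]
  have hlim := tendsto_atTop_ciInf hanti ⟨B, by rintro _ ⟨j, rfl⟩; exact hB j⟩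
  have hdiff : Tendsto (fun j => (f j - f (j + 1)) / κ) atTop (𝓝 0) := by
    simpa using (hlim.sub (hlim.comp (tendsto_add_atTop_nat 1))).div_const κ
  have hsq : Tendsto (fun j => a j ^ 2) atTop (𝓝 0) :=
    squeeze_zero (fun j => by positivity)
      (fun j => by rw [le_div_iff₀ hκ]; linarith [hf j]) hdiff
  have := hsq.sqrt
  simpa [Real.sqrt_sq (ha _)] using this

theorem mul_norm_le_of_coercive {α : ℝ} {y g : E n} (h : α * ‖y‖ ^ 2 ≤ inner ℝ g y) :
    α * ‖y‖ ≤ ‖g‖ := by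
  rcases (norm_nonneg y).eq_or_lt with h0 | h0
  · rw [← h0, mul_zero]
    exact norm_nonneg _
  · refine le_of_mul_le_mul_right ?_ h0
    linarith [real_inner_le_norm g y]

namespace QPData

variable (D : QPData n)

theorem strongConvex_psi (hQ : D.Q.PosSemidef) (hne : D.feasible.Nonempty) (x : E n) {σ : ℝ}
    (hσ : 0 < σ) {α : ℝ} (hlow : ∀ w ∈ D.ranQ, α * ‖w‖ ^ 2 ≤ inner ℝ w (D.Qop w)) {w w' : E n}
    (hw : w ∈ D.ranQ) (hw' : w' ∈ D.ranQ) :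
    D.psi x σ w + inner ℝ (D.psiGrad x σ w) (w' - w) + 1 / 2 * α * ‖w' - w‖ ^ 2
      ≤ D.psi x σ w' := by
  have h1 := D.le_psi_sub hQ hne x hσ w w'
  have h2 := hlow _ (D.ranQ.sub_mem hw' hw)
  have h3 : 0 ≤ 1 / σ * (1 / 2 * ‖D.projArg x σ w' - D.projArg x σ w‖ ^ 2) := by positivity
  linarith

theorem strongMonotone_psiGrad (hQ : D.Q.PosSemidef) (hne : D.feasible.Nonempty) (x : E n) {σ : ℝ}
    (hσ : 0 < σ) {α : ℝ} (hlow : ∀ w ∈ D.ranQ, α * ‖w‖ ^ 2 ≤ inner ℝ w (D.Qop w)) {w w' : E n}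
    (hw : w ∈ D.ranQ) (hw' : w' ∈ D.ranQ) :
    α * ‖w' - w‖ ^ 2 ≤ inner ℝ (D.psiGrad x σ w' - D.psiGrad x σ w) (w' - w) := by
  have h1 := D.strongConvex_psi hQ hne x hσ hlow hw hw'
  have h2 := D.strongConvex_psi hQ hne x hσ hlow hw' hw
  rw [norm_sub_rev w w', ← neg_sub w' w, inner_neg_right] at h2
  rw [inner_sub_left]
  linarith

/-- The sequence itself produces the solution: gradients tending to zero along a sequence in
`Ran(Q)` make it Cauchy, by strong monotonicity. -/
theorem exists_tendsto_of_psiGrad_tendsto_zero (hQ : D.Q.PosSemidef) (hne : D.feasible.Nonempty)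
    (x : E n) {σ : ℝ} (hσ : 0 < σ) {w : ℕ → E n} (hw : ∀ j, w j ∈ D.ranQ)
    (hg : Tendsto (fun j => ‖D.psiGrad x σ (w j)‖) atTop (𝓝 0)) :
    ∃ wt ∈ D.ranQ, Tendsto w atTop (𝓝 wt) ∧ D.psiGrad x σ wt = 0 := by
  obtain ⟨α, hα, hlow⟩ := D.exists_coercive hQ
  have hcauchy : CauchySeq w := by
    refine Metric.cauchySeq_iff.2 fun ε hε => ?_
    obtain ⟨N, hN⟩ := eventually_atTop.1 (hg.eventually (gt_mem_nhds (by positivity :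
      0 < α * ε / 2)))
    refine ⟨N, fun i hi j hj => ?_⟩
    have h1 := mul_norm_le_of_coercive (D.strongMonotone_psiGrad hQ hne x hσ hlow (hw j) (hw i))
    have h2 := norm_sub_le (D.psiGrad x σ (w i)) (D.psiGrad x σ (w j))
    have h3 := hN i hi
    have h4 := hN j hj
    rw [dist_eq_norm]
    refine lt_of_mul_lt_mul_left ?_ hα.le
    linarith
  obtain ⟨wt, hwt⟩ := cauchySeq_tendsto_of_complete hcauchy
  refine ⟨wt, (Submodule.closed_of_finiteDimensional D.ranQ).mem_of_tendsto hwt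
    (Eventually.of_forall hw), hwt, ?_⟩
  have hcont : Continuous (D.psiGrad x σ) :=
    (LipschitzWith.of_dist_le_mul (K := Real.toNNReal (‖D.Qop‖ + σ * ‖D.Qop‖ ^ 2))
      fun v v' => by
        rw [Real.coe_toNNReal _ (by positivity), dist_eq_norm, dist_eq_norm]
        exact D.norm_psiGrad_sub_le hne x hσ v v').continuous
  exact norm_eq_zero.1 (tendsto_nhds_unique ((hcont.tendsto wt).comp hwt).norm hg)

/-- Inexact Newton directions are uniformly gradient related, with constants depending only on the
bounds `α` and `β` for the generalized Hessians. -/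
theorem newtonDirection_descent (hQ : D.Q.PosSemidef) (hne : D.feasible.Nonempty) (x : E n)
    {σ : ℝ} (hσ : 0 < σ) {α : ℝ} (hα : 0 < α)
    (hlow : ∀ w ∈ D.ranQ, α * ‖w‖ ^ 2 ≤ inner ℝ w (D.Qop w)) {β : ℝ} (hβ : 0 < β)
    (hup : ‖D.Qop‖ + σ * ‖D.Qop‖ ^ 2 ≤ β) {τ η : ℝ} (hτ : 0 < τ) (hη : η < 1) {w d : E n}
    (hd : D.IsNewtonDirection x σ τ η w d) :
    1 / (2 * β) * ‖D.psiGrad x σ w‖ ^ 2 ≤ -inner ℝ (D.psiGrad x σ w) d ∧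
      ‖d‖ ≤ 2 / α * ‖D.psiGrad x σ w‖ := by
  obtain ⟨P, hP, ⟨i, rfl⟩, -, hres⟩ := hd
  rw [D.gradient_psi hQ hne x hσ] at *
  rcases i with _ | i
  · -- the zero direction passes the residual test only at a stationary point
    have hsol : (cgIter (D.newtonOp σ P) (-D.psiGrad x σ w) 0).sol = 0 := rfl
    rw [hsol, map_zero, zero_add] at hres
    have hg : ‖D.psiGrad x σ w‖ = 0 := by
      by_contra h0
      have hpos := lt_of_le_of_ne (norm_nonneg _) (Ne.symm h0)
      have hlt := (hres.trans (min_le_left _ _)).trans_lt hη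
      have := Real.rpow_lt_rpow_of_exponent_gt hpos hlt (by linarith : 1 < 1 + τ)
      rw [Real.rpow_one] at this
      linarith [hres.trans (min_le_right _ _)]
    rw [hsol, norm_eq_zero.1 hg]
    simp
  · have h := cgIter_succ_descent (D.newtonOp_inner_comm hQ σ hP)
      (fun v _ => D.newtonOp_mem_ranQ σ P v) hα
      (fun v hv => (hlow v hv).trans (D.inner_Qop_le_inner_newtonOp hQ hσ hP v)) hβ
      (fun v => (D.inner_newtonOp_le hQ hσ hP v).trans
        (mul_le_mul_of_nonneg_right hup (by positivity)))
      (D.ranQ.neg_mem (D.psiGrad_mem_ranQ x σ w)) i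
    rwa [norm_neg, inner_neg_left] at h

theorem ssN_mem_ranQ {x : E n} {σ μ δ τ η : ℝ} {w : ℕ → E n}
    (hw : D.IsSsNSequence x σ μ δ τ η w) (j : ℕ) : w j ∈ D.ranQ := by
  induction j with
  | zero => exact hw.1
  | succ j ih =>
    obtain ⟨d, m, ⟨P, -, -, hd, -⟩, -, heq⟩ := hw.2 j
    rw [heq]
    exact D.ranQ.add_mem ih (D.ranQ.smul_mem _ hd)

theorem psi_add_le (hQ : D.Q.PosSemidef) (hne : D.feasible.Nonempty) (x : E n) {σ : ℝ}
    (hσ : 0 < σ) {β : ℝ} (hup : ‖D.Qop‖ + σ * ‖D.Qop‖ ^ 2 ≤ β) (w d : E n) :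
    D.psi x σ (w + d)
      ≤ D.psi x σ w + inner ℝ (D.psiGrad x σ w) d + 1 / 2 * β * ‖d‖ ^ 2 := by
  have h := D.psi_sub_le hQ hne x hσ w (w + d)
  rw [add_sub_cancel_left] at h
  nlinarith [mul_le_mul_of_nonneg_right hup (sq_nonneg ‖d‖)]

/-- Every step decreases `ψ` by a multiple of the squared gradient norm, and `ψ` is bounded below on
`Ran(Q)`. -/
theorem ssN_psiGrad_tendsto_zero (hQ : D.Q.PosSemidef) (hne : D.feasible.Nonempty) {x : E n}
    {σ : ℝ} (hσ : 0 < σ) {μ δ τ η : ℝ} (hμ : μ ∈ Set.Ioo (0 : ℝ) (1 / 2))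
    (hδ : δ ∈ Set.Ioo (0 : ℝ) 1) (hτ : 0 < τ) (hη : η < 1) {w : ℕ → E n}
    (hw : D.IsSsNSequence x σ μ δ τ η w) :
    Tendsto (fun j => ‖D.psiGrad x σ (w j)‖) atTop (𝓝 0) := by
  obtain ⟨α, hα, hlow⟩ := D.exists_coercive hQ
  obtain ⟨β, hβ, hup⟩ : ∃ β, 0 < β ∧ ‖D.Qop‖ + σ * ‖D.Qop‖ ^ 2 ≤ β :=
    ⟨‖D.Qop‖ + σ * ‖D.Qop‖ ^ 2 + 1, by positivity, by linarith⟩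
  have hδ0 := hδ.1
  have hμ0 := hμ.1
  refine tendsto_zero_of_sufficient_decrease (f := fun j => D.psi x σ (w j))
    (κ := μ * (1 / (2 * β)) * min 1 (δ * (1 / (2 * β) / (β * (2 / α) ^ 2))))
    (B := D.psi x σ (w 0) - 1 / (2 * α) * ‖D.psiGrad x σ (w 0)‖ ^ 2)
    (by positivity) (fun j => norm_nonneg _) (fun j => ?_) (fun j => ?_)
  · -- the lower bound is the minimum of the strongly convex quadratic minorant at `w 0`
    have h1 := D.strongConvex_psi hQ hne x hσ hlow (D.ssN_mem_ranQ hw 0) (D.ssN_mem_ranQ hw j)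
    have h2 := neg_le_of_abs_le (abs_real_inner_le_norm (D.psiGrad x σ (w 0)) (w j - w 0))
    have h3 : 1 / (2 * α) * ‖D.psiGrad x σ (w 0)‖ ^ 2 - ‖D.psiGrad x σ (w 0)‖ * ‖w j - w 0‖
        + 1 / 2 * α * ‖w j - w 0‖ ^ 2
        = 1 / (2 * α) * (‖D.psiGrad x σ (w 0)‖ - α * ‖w j - w 0‖) ^ 2 := by
      field_simp
      ring
    have h4 : 0 ≤ 1 / (2 * α) * (‖D.psiGrad x σ (w 0)‖ - α * ‖w j - w 0‖) ^ 2 := by positivity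
    linarith
  · obtain ⟨d, m, hd, hm, heq⟩ := hw.2 j
    obtain ⟨h1, h2⟩ := D.newtonDirection_descent hQ hne x hσ hα hlow hβ hup hτ hη hd
    rw [heq]
    refine lineSearch_decrease hβ (by positivity) (by positivity) hμ hδ (fun t => ?_) h1 h2 ?_
    · have := D.psi_add_le hQ hne x hσ hup (w j) (t • d)
      rwa [real_inner_smul_right, norm_smul, mul_pow, Real.norm_eq_abs, sq_abs] at this
    · simpa only [LineSearchCond, D.gradient_psi hQ hne x hσ] using hm

/-! ### Local convergence rate -/

/-- Exactness of the HS-Jacobian makes the gradient difference equal to the generalized Hessian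
applied to the error `w - wt`, and `ψ(w) - ψ(wt)` at least half the pairing of gradient and error.
The factor `½` is what makes the line search accept unit steps for every `μ < ½`. -/
theorem eventually_psiGrad_eq_newtonOp (hQ : D.Q.PosSemidef) (hne : D.feasible.Nonempty) (x : E n)
    {σ : ℝ} (hσ : 0 < σ) {wt : E n} (hwt : D.psiGrad x σ wt = 0) :
    ∀ᶠ w in 𝓝 wt, ∀ P ∈ D.hsJacobian (D.uArg x σ w),
      D.psiGrad x σ w = D.newtonOp σ P (w - wt) ∧
      1 / 2 * inner ℝ (D.psiGrad x σ w) (w - wt) ≤ D.psi x σ w - D.psi x σ wt := by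
  have hcont : Continuous (D.uArg x σ) := by
    unfold uArg
    fun_prop
  filter_upwards [(hcont.tendsto wt).eventually (D.eventually_hsJacobian_apply hne (D.uArg x σ wt))]
    with w hw P hP
  have h1 : P (D.uArg x σ w - D.uArg x σ wt) = D.projArg x σ w - D.projArg x σ wt := hw P hP
  have hgrad : D.psiGrad x σ w = D.newtonOp σ P (w - wt) := by
    rw [uArg_sub, map_neg, map_smul] at h1
    rw [newtonOp_apply, ← sub_zero (D.psiGrad x σ w), ← hwt, psiGrad, psiGrad, ← map_sub]
    congr 1
    rw [neg_eq_iff_eq_neg.1 h1]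
    abel
  refine ⟨hgrad, ?_⟩
  have h2 := D.le_psi_sub hQ hne x hσ wt w
  rw [hwt, inner_zero_left, sub_zero] at h2
  -- `P` is an orthogonal projector, so `‖P y‖² = ⟨y, P y⟩`
  have h3 : ‖D.projArg x σ w - D.projArg x σ wt‖ ^ 2
      = σ ^ 2 * inner ℝ (D.Qop (w - wt)) (P (D.Qop (w - wt))) := by
    rw [← h1, uArg_sub, map_neg, map_smul, norm_neg, norm_smul, mul_pow, Real.norm_eq_abs, sq_abs]
    obtain ⟨J, -, rfl⟩ := hP
    congr 1
    rw [real_inner_comm]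
    exact (Submodule.re_inner_starProjection_eq_normSq
      (Submodule.span ℝ (insert D.a (rowA '' J)))ᗮ _).symm
  rw [hgrad, real_inner_comm, D.inner_newtonOp hQ]
  refine le_trans (le_of_eq ?_) h2
  rw [h3]
  field_simp

/-- The inexact Newton step from points near the solution is accurate of order `1 + τ`, and it is
accepted by the line search with unit step length. -/
theorem eventually_newton_step (hQ : D.Q.PosSemidef) (hne : D.feasible.Nonempty) (x : E n)
    {σ : ℝ} (hσ : 0 < σ) {μ τ η : ℝ} (hμ : μ ∈ Set.Ioo (0 : ℝ) (1 / 2)) (hτ : 0 < τ)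
    {wt : E n} (hwt : wt ∈ D.ranQ) (hgt : D.psiGrad x σ wt = 0) :
    ∃ C : ℝ, ∀ᶠ w in 𝓝 wt, w ∈ D.ranQ → ∀ d, D.IsNewtonDirection x σ τ η w d →
      ‖w + d - wt‖ ≤ C * ‖w - wt‖ ^ (1 + τ) ∧
      D.psi x σ (w + d) ≤ D.psi x σ w + μ * inner ℝ (D.psiGrad x σ w) d := by
  obtain ⟨α, hα, hlow⟩ := D.exists_coercive hQ
  obtain ⟨β, hβ, hup⟩ : ∃ β, 0 < β ∧ ‖D.Qop‖ + σ * ‖D.Qop‖ ^ 2 ≤ β :=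
    ⟨‖D.Qop‖ + σ * ‖D.Qop‖ ^ 2 + 1, by positivity, by linarith⟩
  obtain ⟨hμ0, hμ1⟩ := hμ
  have hε : 0 < min 1 ((1 / 2 - μ) * α / β) :=
    lt_min one_pos (div_pos (mul_pos (by linarith) hα) hβ)
  refine ⟨β ^ (1 + τ) / α, ?_⟩
  have hsmall : ∀ᶠ w in 𝓝 wt,
      β ^ (1 + τ) / α * ‖w - wt‖ ^ τ < min 1 ((1 / 2 - μ) * α / β) := by
    have hcont : Continuous fun w : E n => β ^ (1 + τ) / α * ‖w - wt‖ ^ τ :=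
      continuous_const.mul (((continuous_id.sub continuous_const).norm).rpow_const
        fun _ => Or.inr hτ.le)
    refine (hcont.tendsto wt).eventually (gt_mem_nhds ?_)
    simpa [Real.zero_rpow hτ.ne'] using hε
  filter_upwards [hsmall, D.eventually_psiGrad_eq_newtonOp hQ hne x hσ hgt]
    with w hw hgrad hmem d hnewton
  obtain ⟨P, hP, -, hd, hres⟩ := hnewton
  rw [D.gradient_psi hQ hne x hσ] at hres
  obtain ⟨hgeq, hhalf⟩ := hgrad P hP
  set e := w - wt with he
  set e' := w + d - wt with he'
  have hde : d = e' - e := by rw [he, he']; abel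
  have hgnorm : ‖D.psiGrad x σ w‖ ≤ β * ‖e‖ := by
    have := D.norm_psiGrad_sub_le hne x hσ w wt
    rw [hgt, sub_zero] at this
    exact this.trans (mul_le_mul_of_nonneg_right hup (norm_nonneg _))
  have hcoer : ∀ y ∈ D.ranQ, α * ‖y‖ ^ 2 ≤ inner ℝ (D.newtonOp σ P y) y := fun y hy => by
    rw [real_inner_comm]
    exact (hlow y hy).trans (D.inner_Qop_le_inner_newtonOp hQ hσ hP y)
  have herr : ‖e'‖ ≤ β ^ (1 + τ) / α * ‖e‖ ^ (1 + τ) := by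
    have h1 : D.newtonOp σ P e' = D.newtonOp σ P d + D.psiGrad x σ w := by
      rw [hgeq, ← map_add, hde]
      congr 1
      abel
    have h2 := mul_norm_le_of_coercive
      (hcoer e' (D.ranQ.sub_mem (D.ranQ.add_mem hmem hd) hwt))
    rw [h1] at h2
    have h3 := (h2.trans (hres.trans (min_le_right _ _))).trans
      (Real.rpow_le_rpow (norm_nonneg _) hgnorm (by linarith))
    rw [Real.mul_rpow hβ.le (norm_nonneg _)] at h3
    rw [div_mul_eq_mul_div, le_div_iff₀ hα]
    linarith
  refine ⟨herr, ?_⟩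
  rw [Real.rpow_one_add' (norm_nonneg _) (by linarith)] at herr
  have hlin : ‖e'‖ ≤ min 1 ((1 / 2 - μ) * α / β) * ‖e‖ := by
    have := mul_le_mul_of_nonneg_right hw.le (norm_nonneg e)
    linarith
  have h1 : ‖e'‖ ≤ ‖e‖ :=
    hlin.trans ((mul_le_mul_of_nonneg_right (min_le_left _ _) (norm_nonneg _)).trans_eq
      (one_mul _))
  have h2 : β * ‖e'‖ ≤ (1 / 2 - μ) * α * ‖e‖ := by
    have := hlin.trans (mul_le_mul_of_nonneg_right (min_le_right _ _) (norm_nonneg e))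
    rw [div_mul_eq_mul_div, le_div_iff₀ hβ] at this
    linarith
  -- the decrease is `ψ(w) - ψ(wt) ≥ ½⟨g, e⟩` up to terms that are small relative to `‖e‖²`, and
  -- `⟨g, d⟩ = ⟨g, e'⟩ - ⟨g, e⟩`
  have h3 : D.psi x σ (w + d) ≤ D.psi x σ wt + 1 / 2 * β * ‖e'‖ ^ 2 := by
    have := D.psi_add_le hQ hne x hσ hup wt e'
    rwa [hgt, inner_zero_left, add_zero, he', add_sub_cancel] at this
  have h4 : inner ℝ (D.psiGrad x σ w) d
      = inner ℝ (D.psiGrad x σ w) e' - inner ℝ (D.psiGrad x σ w) e := by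
    rw [hde, inner_sub_right]
  have h5 : -(β * ‖e‖ * ‖e'‖) ≤ inner ℝ (D.psiGrad x σ w) e' :=
    (neg_le_neg (mul_le_mul_of_nonneg_right hgnorm (norm_nonneg _))).trans
      (neg_le_of_abs_le (abs_real_inner_le_norm _ _))
  have h6 : α * ‖e‖ ^ 2 ≤ inner ℝ (D.psiGrad x σ w) e := by
    rw [hgeq]
    exact hcoer e (D.ranQ.sub_mem hmem hwt)
  have h7 := mul_le_mul_of_nonneg_right h2 (norm_nonneg e)
  have h8 := mul_le_mul_of_nonneg_left h6 (by linarith : 0 ≤ 1 / 2 - μ)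
  have h9 := mul_le_mul_of_nonneg_left h1 (by positivity : 0 ≤ 1 / 2 * β * ‖e'‖)
  have h10 := mul_le_mul_of_nonneg_left h5 hμ0.le
  have h11 := mul_le_mul_of_nonneg_right hμ1.le (by positivity : 0 ≤ β * ‖e‖ * ‖e'‖)
  rw [h4]
  nlinarith

end QPData

end SsN

theorem mainTheorem2 (n : ℕ) (D : SsN.QPData n)
    (hQ : D.Q.PosSemidef) (hlu : ∀ i, D.l i < D.u i) (hne : D.feasible.Nonempty)
    (x : SsN.E n) (σ : ℝ) (hσ : 0 < σ)
    (μ δ τ η : ℝ) (hμ : μ ∈ Set.Ioo (0 : ℝ) (1 / 2)) (hδ : δ ∈ Set.Ioo (0 : ℝ) 1)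
    (hτ : τ ∈ Set.Ioc (0 : ℝ) 1) (hη : η ∈ Set.Ioo (0 : ℝ) 1)
    (w : ℕ → SsN.E n) (hw : D.IsSsNSequence x σ μ δ τ η w) :
    Differentiable ℝ (D.psi x σ) ∧
    ∃ wt ∈ D.ranQ,
      IsMinOn (D.psi x σ) D.ranQ wt ∧
      (∀ v ∈ D.ranQ, gradient (D.psi x σ) v = 0 ↔ v = wt) ∧
      Tendsto w atTop (𝓝 wt) ∧
      (fun j => ‖w (j + 1) - wt‖) =O[atTop] (fun j => ‖w j - wt‖ ^ (1 + τ)) := by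
  refine ⟨fun v => (D.hasGradientAt_psi hQ hne x hσ v).differentiableAt, ?_⟩
  have hmem := D.ssN_mem_ranQ hw
  obtain ⟨wt, hwt, hlim, hgt⟩ := D.exists_tendsto_of_psiGrad_tendsto_zero hQ hne x hσ hmem
    (D.ssN_psiGrad_tendsto_zero hQ hne hσ hμ hδ hτ.1 hη.2 hw)
  obtain ⟨α, hα, hlow⟩ := D.exists_coercive hQ
  refine ⟨wt, hwt, fun v hv => ?_, fun v hv => ?_, hlim, ?_⟩
  · have h := D.strongConvex_psi hQ hne x hσ hlow hwt hv
    rw [hgt, inner_zero_left] at h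
    have : 0 ≤ 1 / 2 * α * ‖v - wt‖ ^ 2 := by positivity
    simp only [Set.mem_ofPred_eq]
    linarith
  · rw [D.gradient_psi hQ hne x hσ]
    refine ⟨fun h => ?_, fun h => h ▸ hgt⟩
    have h1 := SsN.mul_norm_le_of_coercive
      (D.strongMonotone_psiGrad hQ hne x hσ hlow hwt hv)
    rw [h, hgt, sub_zero, norm_zero] at h1
    have h2 : ‖v - wt‖ ≤ 0 := by
      by_contra! h3
      linarith [mul_pos hα h3]
    exact sub_eq_zero.1 (norm_le_zero_iff.1 h2)
  · obtain ⟨C, hC⟩ := D.eventually_newton_step (η := η) hQ hne x hσ hμ hτ.1 hwt hgt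
    refine IsBigO.of_bound C ((hlim.eventually hC).mono fun j hj => ?_)
    obtain ⟨d, m, hd, hm, heq⟩ := hw.2 j
    obtain ⟨h1, h2⟩ := hj (hmem j) d hd
    -- the unit step passes the line search, so it is the one taken
    have hm0 : m = 0 := by
      refine Nat.le_zero.1 (hm.2 ?_)
      change D.psi x σ (w j + δ ^ 0 • d) ≤ _
      rwa [pow_zero, one_smul, mul_one, D.gradient_psi hQ hne x hσ]
    rw [hm0, pow_zero, one_smul] at heq
    rw [heq, norm_norm, Real.norm_of_nonneg (by positivity)]
    exact h1
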